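/- Let $\mathcal L_{\mathbb N}$ be the first-order language of arithmetic with equality, with signature $\{0,\mathrm S,+,\times\}$ and logical constants $\neg,\wedge,\forall$, and let $\mathcal L_T=\mathcal L_{\mathbb N}\cup\{T\}$ with $T$ a unary predicate symbol. Formulas that differ only in the names of bound variables are identified. Fix a Gödel numbering $\varphi\mapsto\#\varphi\in\mathbb N$ that is injective on the sentences of $\mathcal L_T$, and write $\overline n$ for the numeral of $n$. Sequents $\Gamma\Rightarrow\Delta$ consist of finite multisets of formulas. The calculus $\mathrm Q^g$ has the initial sequents $\Gamma,s=t\Rightarrow s=t,\Delta$ and $\Gamma,\mathrm S x=0\Rightarrow\Delta$ and the following rules (premises / conclusion), where $s,t$ are terms and $x,y$ are variables: - cut: $\Gamma\Rightarrow\Delta,\varphi$ and $\varphi,\Gamma\Rightarrow\Delta$ / $\Gamma\Rightarrow\Delta$; - $\neg$: $\Gamma\Rightarrow\varphi,\Delta$ / $\Gamma,\neg\varphi\Rightarrow\Delta$; and $\Gamma,\varphi\Rightarrow\Delta$ / $\Gamma\Rightarrow\neg\varphi,\Delta$; - $\wedge$: $\Gamma,\varphi,\psi\Rightarrow\Delta$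 / $\Gamma,\varphi\wedge\psi\Rightarrow\Delta$; and $\Gamma\Rightarrow\varphi,\Delta$ and $\Gamma\Rightarrow\psi,\Delta$ / $\Gamma\Rightarrow\varphi\wedge\psi,\Delta$; - $\forall$: $\Gamma,\forall x\varphi,\varphi(s/x)\Rightarrow\Delta$ / $\Gamma,\forall x\varphi\Rightarrow\Delta$; and $\Gamma\Rightarrow\varphi(y/x),\Delta$ / $\Gamma\Rightarrow\forall x\varphi,\Delta$, with $y$ not free in $\Gamma,\Delta,\forall x\varphi$; - identity: $\Gamma,t=t\Rightarrow\Delta$ / $\Gamma\Rightarrow\Delta$; and $s=t,\varphi(s),\varphi(t),\Gamma\Rightarrow\Delta$ / $s=t,\varphi(t),\Gamma\Rightarrow\Delta$, with $\varphi(v)$ an atomic formula of $\mathcal L_{\mathbb N}$; - $\Gamma,x=y,\mathrm S x=\mathrm S y\Rightarrow\Delta$ / $\Gamma,\mathrm S x=\mathrm S y\Rightarrow\Delta$; - $\Gamma,x=0\Rightarrow\Delta$ and $\Gamma,x=\mathrm S y\Rightarrow\Delta$ / $\Gamma\Rightarrow\Delta$, with $y$ distinct from $x$ and not free in $\Gamma,\Delta$;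 - $\Gamma,\varepsilon\Rightarrow\Delta$ / $\Gamma\Rightarrow\Delta$, where $\varepsilon$ is one of $x+0=x$, $\;x+\mathrm S y=\mathrm S(x+y)$, $\;x\times 0=0$, $\;x\times\mathrm S y=(x\times y)+x$. The calculus $\mathrm{LPT}_{\mathbb N}$ is $\mathrm Q^g$ formulated in $\mathcal L_T$ together with the truth rules $\Gamma,\varphi\Rightarrow\Delta$ / $\Gamma,T\overline{\#\varphi}\Rightarrow\Delta$ and $\Gamma\Rightarrow\varphi,\Delta$ / $\Gamma\Rightarrow T\overline{\#\varphi},\Delta$, for every sentence $\varphi$ of $\mathcal L_T$. Then $\mathrm{LPT}_{\mathbb N}$ is a conservative extension of $\mathrm Q^g$: every sequent of $\mathcal L_T$ derivable in $\mathrm Q^g$ is derivable in $\mathrm{LPT}_{\mathbb N}$, and for every sequent $\Gamma\Rightarrow\Delta$ of $\mathcal L_{\mathbb N}$ the following are equivalent: it is derivable in $\mathrm{LPT}_{\mathbb N}$; it is derivable in $\mathrm Q^g$ formulated in $\mathcal L_T$ (without truth rules); it is derivable in $\mathrm Q^g$ formulated in $\mathcal L_{\mathbb N}$, that is, by a derivation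 in which only formulas of $\mathcal L_{\mathbb N}$ occur. -/

import Mathlib

/-- Terms over the signature `0, S, +, ×`. Free variables are named by natural numbers,
`n` is the number of bound variables in scope (de Bruijn indices, `0` the innermost binder),
so formulas that differ only in the names of bound variables are identified. -/
inductive Tm : ℕ → Type
  | fvar {n : ℕ} (x : ℕ) : Tm n
  | bvar {n : ℕ} (i : Fin n) : Tm n
  | zero {n : ℕ} : Tm n
  | succ {n : ℕ} (t : Tm n) : Tm n
  | add {n : ℕ} (s t : Tm n) : Tm n
  | mul {n : ℕ} (s t : Tm n) : Tm n

namespace Tm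

/-- Simultaneous substitution of terms for the bound variables in scope. -/
def subst {n m : ℕ} (σ : Fin n → Tm m) : Tm n → Tm m
  | fvar x => fvar x
  | bvar i => σ i
  | zero => zero
  | succ t => succ (t.subst σ)
  | add s t => add (s.subst σ) (t.subst σ)
  | mul s t => mul (s.subst σ) (t.subst σ)

/-- Weakening of the scope by one more (innermost) bound variable. -/
def shift {n : ℕ} (t : Tm n) : Tm (n + 1) := t.subst fun i => bvar i.succ

/-- The (free) variables of a term. -/
def fv {n : ℕ} : Tm n → Finset ℕ
  | fvar x => {x}
  | bvar _ => ∅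
  | zero => ∅
  | succ t => t.fv
  | add s t => s.fv ∪ t.fv
  | mul s t => s.fv ∪ t.fv

/-- `t(s)`, for a term `t(v)` with one place `v`. -/
def inst (t : Tm 1) (s : Tm 0) : Tm 0 := t.subst fun _ => s

/-- The numeral of `k`. -/
def numeral : ℕ → Tm 0
  | 0 => zero
  | k + 1 => succ (numeral k)

end Tm

/-- First-order formulas with primitive `¬, ∧, ∀` in the language of arithmetic with equality,
expanded by one unary predicate symbol for each element of `U`. `Fml U 0` is the type of formulas
proper; `Fml U n` has `n` bound variables in scope. -/
inductive Fml (U : Type) : ℕ → Type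
  | eq {n : ℕ} (s t : Tm n) : Fml U n
  | pred {n : ℕ} (u : U) (t : Tm n) : Fml U n
  | neg {n : ℕ} (φ : Fml U n) : Fml U n
  | and {n : ℕ} (φ ψ : Fml U n) : Fml U n
  | all {n : ℕ} (φ : Fml U (n + 1)) : Fml U n

namespace Fml

variable {U : Type}

/-- Simultaneous substitution of terms for the bound variables in scope. -/
def subst : {n m : ℕ} → (Fin n → Tm m) → Fml U n → Fml U m
  | _, _, σ, eq s t => eq (s.subst σ) (t.subst σ)
  | _, _, σ, pred u t => pred u (t.subst σ)
  | _, _, σ, neg φ => neg (subst σ φ)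
  | _, _, σ, and φ ψ => and (subst σ φ) (subst σ ψ)
  | _, _, σ, all φ => all (subst (Fin.cases (Tm.bvar 0) fun i => (σ i).shift) φ)

/-- `φ(s/x)`, where `φ` is the matrix of `∀ x φ`. -/
def inst (φ : Fml U 1) (s : Tm 0) : Fml U 0 := φ.subst fun _ => s

/-- The free variables of a formula. -/
def fv : {n : ℕ} → Fml U n → Finset ℕ
  | _, eq s t => s.fv ∪ t.fv
  | _, pred _ t => t.fv
  | _, neg φ => fv φ
  | _, and φ ψ => fv φ ∪ fv ψ
  | _, all φ => fv φ

/-- A sentence is a formula without free variables. -/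
def IsSentence (φ : Fml U 0) : Prop := φ.fv = ∅

end Fml

/-- Formulas of the language `L_ℕ` of arithmetic. -/
abbrev ArithFml : ℕ → Type := Fml Empty

/-- Formulas of `L_ℕ ∪ {T}`. -/
abbrev TruthFml : ℕ → Type := Fml Unit

/-- The atomic formula `T t`. -/
abbrev TruthFml.T {n : ℕ} (t : Tm n) : TruthFml n := Fml.pred () t

/-- The inclusion of `L_ℕ` in `L_ℕ ∪ {T}`. -/
def ArithFml.toTruth : {n : ℕ} → ArithFml n → TruthFml n
  | _, .eq s t => .eq s t
  | _, .pred u _ => u.elim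
  | _, .neg φ => .neg (ArithFml.toTruth φ)
  | _, .and φ ψ => .and (ArithFml.toTruth φ) (ArithFml.toTruth ψ)
  | _, .all φ => .all (ArithFml.toTruth φ)

/-- `x` is not free in any formula of `Γ`. -/
def NotFreeIn {U : Type} (x : ℕ) (Γ : Multiset (Fml U 0)) : Prop := ∀ φ ∈ Γ, x ∉ φ.fv

open Fml Tm in
/-- Derivability of the sequent `Γ ⇒ Δ` (`Γ`, `Δ` finite multisets) in the G3-style calculus with
cut, initial sequents for equations only, the rules for identity, the geometric rules of Robinson
arithmetic, and the left and right rules that pass from `φ` to `ψ` for every pair with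
`Names φ ψ`, to be read as: `ψ` is the truth ascription to `φ`. -/
inductive Derivable {U : Type} (Names : Fml U 0 → Fml U 0 → Prop) :
    Multiset (Fml U 0) → Multiset (Fml U 0) → Prop
  | ref {Γ Δ} (s t : Tm 0) : Derivable Names (eq s t ::ₘ Γ) (eq s t ::ₘ Δ)
  | cut {Γ Δ} (φ : Fml U 0) : Derivable Names Γ (φ ::ₘ Δ) → Derivable Names (φ ::ₘ Γ) Δ →
      Derivable Names Γ Δ
  | negL {Γ Δ} (φ : Fml U 0) : Derivable Names Γ (φ ::ₘ Δ) → Derivable Names (neg φ ::ₘ Γ) Δ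
  | negR {Γ Δ} (φ : Fml U 0) : Derivable Names (φ ::ₘ Γ) Δ → Derivable Names Γ (neg φ ::ₘ Δ)
  | andL {Γ Δ} (φ ψ : Fml U 0) : Derivable Names (φ ::ₘ ψ ::ₘ Γ) Δ →
      Derivable Names (and φ ψ ::ₘ Γ) Δ
  | andR {Γ Δ} (φ ψ : Fml U 0) : Derivable Names Γ (φ ::ₘ Δ) → Derivable Names Γ (ψ ::ₘ Δ) →
      Derivable Names Γ (and φ ψ ::ₘ Δ)
  | allL {Γ Δ} (φ : Fml U 1) (s : Tm 0) : Derivable Names (all φ ::ₘ φ.inst s ::ₘ Γ) Δ →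
      Derivable Names (all φ ::ₘ Γ) Δ
  | allR {Γ Δ} (φ : Fml U 1) (y : ℕ) : NotFreeIn y Γ → NotFreeIn y Δ → y ∉ (all φ).fv →
      Derivable Names Γ (φ.inst (fvar y) ::ₘ Δ) → Derivable Names Γ (all φ ::ₘ Δ)
  | eq1 {Γ Δ} (t : Tm 0) : Derivable Names (eq t t ::ₘ Γ) Δ → Derivable Names Γ Δ
  /-- Replacement in the atomic formula `a(v) = b(v)` of the language of arithmetic. -/
  | eq2 {Γ Δ} (s t : Tm 0) (a b : Tm 1) :
      Derivable Names
        (eq s t ::ₘ eq (a.inst s) (b.inst s) ::ₘ eq (a.inst t) (b.inst t) ::ₘ Γ) Δ →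
      Derivable Names (eq s t ::ₘ eq (a.inst t) (b.inst t) ::ₘ Γ) Δ
  | q1 {Γ Δ} (x : ℕ) : Derivable Names (eq (succ (fvar x)) zero ::ₘ Γ) Δ
  | q2 {Γ Δ} (x y : ℕ) :
      Derivable Names
        (eq (fvar x) (fvar y) ::ₘ eq (succ (fvar x)) (succ (fvar y)) ::ₘ Γ) Δ →
      Derivable Names (eq (succ (fvar x)) (succ (fvar y)) ::ₘ Γ) Δ
  | q3 {Γ Δ} (x y : ℕ) : NotFreeIn y Γ → NotFreeIn y Δ → y ≠ x →
      Derivable Names (eq (fvar x) zero ::ₘ Γ) Δ →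
      Derivable Names (eq (fvar x) (succ (fvar y)) ::ₘ Γ) Δ → Derivable Names Γ Δ
  | q4 {Γ Δ} (x : ℕ) : Derivable Names (eq (add (fvar x) zero) (fvar x) ::ₘ Γ) Δ →
      Derivable Names Γ Δ
  | q5 {Γ Δ} (x y : ℕ) :
      Derivable Names
        (eq (add (fvar x) (succ (fvar y))) (succ (add (fvar x) (fvar y))) ::ₘ Γ) Δ →
      Derivable Names Γ Δ
  | q6 {Γ Δ} (x : ℕ) : Derivable Names (eq (mul (fvar x) zero) zero ::ₘ Γ) Δ →
      Derivable Names Γ Δ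
  | q7 {Γ Δ} (x y : ℕ) :
      Derivable Names
        (eq (mul (fvar x) (succ (fvar y))) (add (mul (fvar x) (fvar y)) (fvar x)) ::ₘ Γ) Δ →
      Derivable Names Γ Δ
  | truthL {Γ Δ} (φ ψ : Fml U 0) : Names φ ψ → Derivable Names (φ ::ₘ Γ) Δ →
      Derivable Names (ψ ::ₘ Γ) Δ
  | truthR {Γ Δ} (φ ψ : Fml U 0) : Names φ ψ → Derivable Names Γ (φ ::ₘ Δ) →
      Derivable Names Γ (ψ ::ₘ Δ)

/-- Derivability in `Q^g`: there are no truth rules. Here `QG` over `ArithFml` uses only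
arithmetical formulas, and `QG` over `TruthFml` is the same calculus in `L_ℕ ∪ {T}`. -/
def QG {U : Type} (Γ Δ : Multiset (Fml U 0)) : Prop := Derivable (fun _ _ => False) Γ Δ

/-- Derivability in `LPT_ℕ`: `Q^g` in the language `L_ℕ ∪ {T}` with the rules that pass, on the
left and on the right, from a sentence `φ` to `T l`, `l` the numeral of the code of `φ`. -/
def LPTN (code : TruthFml 0 → ℕ) (Γ Δ : Multiset (TruthFml 0)) : Prop :=
  Derivable (fun φ ψ => φ.IsSentence ∧ ψ = TruthFml.T (Tm.numeral (code φ))) Γ Δ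

/-!
The underivable arithmetical sequents, ordered by inclusion, are forcing conditions: `Γ ⇒ Δ` forces
`φ` if `Γ ⇒ φ, Δ` is derivable in `Q^g`. Identity and cut make the conditions that force `φ` a
regular set, so that sending `φ` to this set is a valuation of the arithmetical formulas in a
complete Boolean algebra `B`, with the terms as the domain of quantification. It makes the axioms of
Robinson arithmetic true, and a sequent has value `⊤` only if it is derivable.

To interpret `T` over this `B`-valued model of terms, evaluate the formulas of `L_ℕ ∪ {T}` in the
strong Kleene scheme, by independent values in `B` for truth and for falsity, and take Kripke's
least fixed point: as codes are injective, `T` at the code of a sentence has there the value of that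
sentence, which makes the truth rules sound. The least fixed point lies below its own de Morgan
dual, so truth and falsity are disjoint, which makes cut sound. Initial sequents are sound because
they are restricted to equations, whose truth and falsity are complementary. Hence an arithmetical
sequent that is derivable in `LPT_ℕ` has value `⊤`, and so is derivable in `Q^g`.
-/

namespace Tm

variable {n m k : ℕ}

/-- Simultaneous substitution of terms for the free variables and for the bound variables in
scope. Renaming of free variables and evaluation in the term structure are instances of it. -/
def bind (ρ : ℕ → Tm m) (σ : Fin n → Tm m) : Tm n → Tm m
  | fvar x => ρ x
  | bvar i => σ i
  | zero => zero
  | succ t => succ (t.bind ρ σ)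
  | add s t => add (s.bind ρ σ) (t.bind ρ σ)
  | mul s t => mul (s.bind ρ σ) (t.bind ρ σ)

/-- Renaming of the free variables of a term. -/
def ren (ρ : ℕ → ℕ) (t : Tm n) : Tm n := t.bind (fun x => fvar (ρ x)) bvar

theorem bind_bind (ρ : ℕ → Tm m) (σ : Fin n → Tm m) (ρ' : ℕ → Tm k) (σ' : Fin m → Tm k)
    (t : Tm n) :
    (t.bind ρ σ).bind ρ' σ' = t.bind (fun x => (ρ x).bind ρ' σ') fun i => (σ i).bind ρ' σ' := by
  induction t <;> simp_all only [bind]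

theorem bind_fvar (σ : Fin n → Tm m) (t : Tm n) : t.bind fvar σ = t.subst σ := by
  induction t <;> simp_all only [bind, subst]

theorem bind_congr {ρ ρ' : ℕ → Tm m} {σ : Fin n → Tm m} {t : Tm n}
    (h : ∀ x ∈ t.fv, ρ x = ρ' x) : t.bind ρ σ = t.bind ρ' σ := by
  induction t <;> simp_all [bind, fv]

theorem subst_bind (σ : Fin n → Tm m) (ρ : ℕ → Tm k) (τ : Fin m → Tm k) (t : Tm n) :
    (t.subst σ).bind ρ τ = t.bind ρ fun i => (σ i).bind ρ τ := by
  simp only [← bind_fvar, bind_bind, bind]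

theorem subst_subst (σ : Fin n → Tm m) (τ : Fin m → Tm k) (t : Tm n) :
    (t.subst σ).subst τ = t.subst fun i => (σ i).subst τ := by
  simp only [← bind_fvar, bind_bind, bind]

theorem subst_bvar (t : Tm n) : t.subst bvar = t := by
  induction t <;> simp_all only [subst]

theorem subst_fin_zero (σ : Fin 0 → Tm 0) (t : Tm 0) : t.subst σ = t := by
  rw [Subsingleton.elim σ bvar, subst_bvar]

theorem shift_bind (ρ : ℕ → Tm m) (a : Tm m) (σ : Fin n → Tm m) (t : Tm n) :
    t.shift.bind ρ (Fin.cases a σ) = t.bind ρ σ :=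
  subst_bind _ _ _ t

theorem shift_subst_lift (σ : Fin n → Tm m) (t : Tm n) :
    t.shift.subst (Fin.cases (bvar 0) fun i => (σ i).shift) = (t.subst σ).shift := by
  simp only [shift, subst_subst, subst, Fin.cases_succ]

theorem shift_inst (t s : Tm 0) : t.shift.inst s = t := by
  rw [inst, shift, subst_subst, subst_fin_zero]

theorem inst_bind (ρ : ℕ → Tm 0) (σ : Fin 0 → Tm 0) (a : Tm 1) (t : Tm 0) :
    (a.inst t).bind ρ σ = (a.bind (fun x => (ρ x).shift) bvar).inst (t.bind ρ σ) := by
  rw [inst, subst_bind, inst, ← bind_fvar, bind_bind]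
  congr 1
  funext x
  rw [bind_fvar]
  exact (shift_inst (ρ x) _).symm

theorem ren_subst (ρ : ℕ → ℕ) (σ : Fin n → Tm m) (t : Tm n) :
    (t.subst σ).ren ρ = (t.ren ρ).subst fun i => (σ i).ren ρ := by
  simp only [ren, ← bind_fvar, bind_bind, bind]

theorem ren_inst (ρ : ℕ → ℕ) (t : Tm 1) (s : Tm 0) :
    (t.inst s).ren ρ = (t.ren ρ).inst (s.ren ρ) :=
  ren_subst _ _ _

theorem ren_id (t : Tm n) : t.ren id = t :=
  (bind_fvar bvar t).trans (subst_bvar t)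

theorem ren_congr {ρ ρ' : ℕ → ℕ} {t : Tm n} (h : ∀ x ∈ t.fv, ρ x = ρ' x) : t.ren ρ = t.ren ρ' :=
  bind_congr fun x hx => congrArg fvar (h x hx)

theorem numeral_bind (ρ : ℕ → Tm 0) (σ : Fin 0 → Tm 0) (k : ℕ) :
    (numeral k).bind ρ σ = numeral k := by
  induction k with
  | zero => rfl
  | succ k ih => rw [numeral, bind, ih]

theorem numeral_injective : Function.Injective numeral := by
  intro k
  induction k with
  | zero => rintro (_ | l) h <;> simp_all only [numeral, reduceCtorEq]
  | succ k ih =>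
    rintro (_ | l) h
    · simp only [numeral, reduceCtorEq] at h
    · rw [ih (succ.inj h)]

end Tm

namespace Fml

variable {U V : Type} {n m k : ℕ}

/-- Translation along a map `f` of predicate symbols, combined with the renaming `ρ` of the free
variables. Renaming within one language and the inclusion of `L_ℕ` in `L_ℕ ∪ {T}` are instances
of it. -/
def map (f : U → V) (ρ : ℕ → ℕ) : {n : ℕ} → Fml U n → Fml V n
  | _, eq s t => eq (s.ren ρ) (t.ren ρ)
  | _, pred u t => pred (f u) (t.ren ρ)
  | _, neg φ => neg (map f ρ φ)
  | _, and φ ψ => and (map f ρ φ) (map f ρ ψ)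
  | _, all φ => all (map f ρ φ)

theorem subst_subst (σ : Fin n → Tm m) (τ : Fin m → Tm k) (φ : Fml U n) :
    (φ.subst σ).subst τ = φ.subst fun i => (σ i).subst τ := by
  induction φ generalizing m k with
  | eq | pred => simp only [subst, Tm.subst_subst]
  | neg φ ih => simp only [subst, ih]
  | and φ ψ ih ih' => simp only [subst, ih, ih']
  | all φ ih =>
    simp only [subst, ih]
    congr 2
    exact funext (Fin.cases rfl fun i => Tm.shift_subst_lift τ (σ i))

theorem subst_bvar (φ : Fml U n) : φ.subst Tm.bvar = φ := by
  induction φ with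
  | eq | pred => simp only [subst, Tm.subst_bvar]
  | neg φ ih => simp only [subst, ih]
  | and φ ψ ih ih' => simp only [subst, ih, ih']
  | all φ ih =>
    rw [subst]
    conv_rhs => rw [← ih]
    congr 2
    exact funext (Fin.cases rfl fun _ => rfl)

theorem subst_fin_zero (σ : Fin 0 → Tm 0) (φ : Fml U 0) : φ.subst σ = φ := by
  rw [Subsingleton.elim σ Tm.bvar, subst_bvar]

theorem subst_lift_inst (σ : Fin n → Tm 0) (φ : Fml U (n + 1)) (a : Tm 0) :
    (φ.subst (Fin.cases (Tm.bvar 0) fun i => (σ i).shift)).inst a =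
      φ.subst (Fin.cases a σ) := by
  rw [inst, subst_subst]
  congr 1
  exact funext (Fin.cases rfl fun i => Tm.shift_inst (σ i) a)

theorem map_subst (f : U → V) (ρ : ℕ → ℕ) (σ : Fin n → Tm m) (φ : Fml U n) :
    (φ.subst σ).map f ρ = (φ.map f ρ).subst fun i => (σ i).ren ρ := by
  induction φ generalizing m with
  | eq | pred => simp only [subst, map, Tm.ren_subst]
  | neg φ ih => simp only [subst, map, ih]
  | and φ ψ ih ih' => simp only [subst, map, ih, ih']
  | all φ ih =>
    simp only [subst, map, ih]
    congr 2
    exact funext (Fin.cases rfl fun i => Tm.ren_subst ρ _ (σ i))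

theorem map_inst (f : U → V) (ρ : ℕ → ℕ) (φ : Fml U 1) (s : Tm 0) :
    (φ.inst s).map f ρ = (φ.map f ρ).inst (s.ren ρ) :=
  map_subst _ _ _ _

theorem map_id_id (φ : Fml U n) : φ.map id id = φ := by
  induction φ <;> simp_all only [map, Tm.ren_id, id]

theorem map_congr (f : U → V) {ρ ρ' : ℕ → ℕ} {φ : Fml U n} (h : ∀ x ∈ φ.fv, ρ x = ρ' x) :
    φ.map f ρ = φ.map f ρ' := by
  induction φ with
  | eq s t =>
    simp only [fv, Finset.mem_union] at h
    simp only [map, Tm.ren_congr fun x hx => h x (.inl hx), Tm.ren_congr fun x hx => h x (.inr hx)]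
  | pred u t => simp only [map, Tm.ren_congr h]
  | neg φ ih => simp only [map, ih h]
  | and φ ψ ih ih' =>
    simp only [fv, Finset.mem_union] at h
    simp only [map, ih fun x hx => h x (.inl hx), ih' fun x hx => h x (.inr hx)]
  | all φ ih => simp only [map, ih h]

theorem map_update (f : U → V) {φ : Fml U n} {y : ℕ} (h : y ∉ φ.fv) (ρ : ℕ → ℕ) (z : ℕ) :
    φ.map f (Function.update ρ y z) = φ.map f ρ :=
  map_congr f fun _ hx => Function.update_of_ne (ne_of_mem_of_not_mem hx h) _ _

end Fml

theorem ArithFml.toTruth_eq_map {n : ℕ} (φ : ArithFml n) : φ.toTruth = φ.map Empty.elim id := by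
  induction φ with
  | pred u => exact u.elim
  | _ => simp_all only [toTruth, Fml.map, Tm.ren_id]

section Structural

variable {U V : Type} {Γ Δ : Multiset (Fml U 0)}

theorem NotFreeIn.map_update {y : ℕ} (h : NotFreeIn y Γ) (f : U → V) (ρ : ℕ → ℕ) (z : ℕ) :
    Γ.map (Fml.map f (Function.update ρ y z)) = Γ.map (Fml.map f ρ) :=
  Multiset.map_congr rfl fun φ hφ => Fml.map_update f (h φ hφ) ρ z

theorem notFreeIn_zero (x : ℕ) : NotFreeIn x (0 : Multiset (Fml U 0)) :=
  fun _ h => absurd h (Multiset.notMem_zero _)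

theorem exists_notFreeIn (Γ Δ : Multiset (Fml U 0)) (s : Finset ℕ) :
    ∃ z, NotFreeIn z Γ ∧ NotFreeIn z Δ ∧ z ∉ s := by
  obtain ⟨z, hz⟩ := Infinite.exists_notMem_finset (((Γ + Δ).map Fml.fv).sup ∪ s)
  rw [Finset.mem_union, not_or] at hz
  have hfresh : NotFreeIn z (Γ + Δ) := fun φ hφ h =>
    hz.1 (Multiset.le_sup (Multiset.mem_map_of_mem Fml.fv hφ) h)
  exact ⟨z, fun φ hφ => hfresh φ (Multiset.mem_add.2 (.inl hφ)),
    fun φ hφ => hfresh φ (Multiset.mem_add.2 (.inr hφ)), hz.2⟩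

open Fml in
theorem Derivable.map_add {Names : Fml U 0 → Fml U 0 → Prop} {Names' : Fml V 0 → Fml V 0 → Prop}
    (f : U → V) (hNames : ∀ ρ φ ψ, Names φ ψ → Names' (φ.map f ρ) (ψ.map f ρ))
    (h : Derivable Names Γ Δ) (ρ : ℕ → ℕ) (Γ' Δ' : Multiset (Fml V 0)) :
    Derivable Names' (Γ.map (map f ρ) + Γ') (Δ.map (map f ρ) + Δ') := by
  induction h generalizing ρ with
  | @allR Γ Δ φ y hΓ hΔ hφ _ ih =>
    obtain ⟨z, hzΓ, hzΔ, hzφ⟩ :=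
      exists_notFreeIn (Γ.map (map f ρ) + Γ') (Δ.map (map f ρ) + Δ') (φ.map f ρ).fv
    have hprem := ih (Function.update ρ y z)
    rw [Multiset.map_cons, hΓ.map_update f, hΔ.map_update f, map_inst, map_update f (φ := φ) hφ,
      Multiset.cons_add] at hprem
    simpa [map] using Derivable.allR (φ.map f ρ) z hzΓ hzΔ hzφ
      (by simpa [Tm.ren, Tm.bind] using hprem)
  | @q3 Γ Δ x y hΓ hΔ hxy _ _ ih ih' =>
    obtain ⟨z, hzΓ, hzΔ, hzx⟩ :=
      exists_notFreeIn (Γ.map (map f ρ) + Γ') (Δ.map (map f ρ) + Δ') {ρ x}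
    have hprem := ih' (Function.update ρ y z)
    rw [Multiset.map_cons, hΓ.map_update f, hΔ.map_update f] at hprem
    exact .q3 (ρ x) z hzΓ hzΔ (by simpa using hzx)
      (by simpa [map, Tm.ren, Tm.bind] using ih ρ)
      (by simpa [map, Tm.ren, Tm.bind, hxy.symm] using hprem)
  | ref s t => simpa [map] using Derivable.ref _ _
  | cut φ _ _ ih ih' => exact .cut (φ.map f ρ) (by simpa using ih ρ) (by simpa using ih' ρ)
  | negL φ _ ih => simpa [map] using Derivable.negL (φ.map f ρ) (by simpa using ih ρ)
  | negR φ _ ih => simpa [map] using Derivable.negR (φ.map f ρ) (by simpa using ih ρ)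
  | andL φ ψ _ ih => simpa [map] using Derivable.andL _ (ψ.map f ρ) (by simpa using ih ρ)
  | andR φ ψ _ _ ih ih' =>
    simpa [map] using .andR (φ.map f ρ) (ψ.map f ρ) (by simpa using ih ρ) (by simpa using ih' ρ)
  | allL φ s _ ih =>
    simpa [map] using Derivable.allL _ (s.ren ρ) (by simpa [map, map_inst] using ih ρ)
  | eq1 t _ ih => exact .eq1 (t.ren ρ) (by simpa [map] using ih ρ)
  | eq2 s t a b _ ih =>
    simpa [map, Tm.ren_inst] using Derivable.eq2 _ _ (a.ren ρ) (b.ren ρ)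
      (by simpa [map, Tm.ren_inst] using ih ρ)
  | q1 x => simpa [map, Tm.ren, Tm.bind] using Derivable.q1 (ρ x)
  | q2 x y _ ih =>
    simpa [map, Tm.ren, Tm.bind] using
      Derivable.q2 (ρ x) (ρ y) (by simpa [map, Tm.ren, Tm.bind] using ih ρ)
  | q4 x _ ih => exact .q4 (ρ x) (by simpa [map, Tm.ren, Tm.bind] using ih ρ)
  | q5 x y _ ih => exact .q5 (ρ x) (ρ y) (by simpa [map, Tm.ren, Tm.bind] using ih ρ)
  | q6 x _ ih => exact .q6 (ρ x) (by simpa [map, Tm.ren, Tm.bind] using ih ρ)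
  | q7 x y _ ih => exact .q7 (ρ x) (ρ y) (by simpa [map, Tm.ren, Tm.bind] using ih ρ)
  | truthL φ ψ hφψ _ ih =>
    simpa using Derivable.truthL _ _ (hNames ρ _ _ hφψ) (by simpa using ih ρ)
  | truthR φ ψ hφψ _ ih =>
    simpa using Derivable.truthR _ _ (hNames ρ _ _ hφψ) (by simpa using ih ρ)

theorem QG.derivable_add (h : QG Γ Δ) (Names : Fml U 0 → Fml U 0 → Prop)
    (Γ' Δ' : Multiset (Fml U 0)) : Derivable Names (Γ + Γ') (Δ + Δ') := by
  have hid : (Fml.map id id : Fml U 0 → Fml U 0) = id := funext Fml.map_id_id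
  simpa only [hid, Multiset.map_id] using
    Derivable.map_add (Names' := Names) id (fun _ _ _ => False.elim) h id Γ' Δ'

theorem QG.derivable (h : QG Γ Δ) (Names : Fml U 0 → Fml U 0 → Prop) : Derivable Names Γ Δ := by
  simpa only [add_zero] using h.derivable_add Names 0 0

theorem QG.weaken {Γ' Δ' : Multiset (Fml U 0)} (h : QG Γ Δ) (hΓ : Γ ≤ Γ') (hΔ : Δ ≤ Δ') :
    QG Γ' Δ' := by
  obtain ⟨Γ'', rfl⟩ := exists_add_of_le hΓ
  obtain ⟨Δ'', rfl⟩ := exists_add_of_le hΔ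
  exact h.derivable_add _ Γ'' Δ''

end Structural

theorem QG.map_toTruth {Γ Δ : Multiset (ArithFml 0)} (h : QG Γ Δ) :
    QG (Γ.map ArithFml.toTruth) (Δ.map ArithFml.toTruth) := by
  have htr : (ArithFml.toTruth : ArithFml 0 → TruthFml 0) = Fml.map Empty.elim id :=
    funext ArithFml.toTruth_eq_map
  simpa only [htr, add_zero, QG] using
    Derivable.map_add (Names' := fun _ _ => False) Empty.elim (fun _ _ _ => False.elim) h id 0 0

/-! ### Inversion -/

namespace QG

open Fml Tm

theorem identity_subst {n : ℕ} (σ : Fin n → Tm 0) (φ : ArithFml n)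
    (Γ Δ : Multiset (ArithFml 0)) : QG (φ.subst σ ::ₘ Γ) (φ.subst σ ::ₘ Δ) := by
  induction φ generalizing Γ Δ with
  | eq s t => exact .ref _ _
  | pred u => exact u.elim
  | neg φ ih =>
    refine .negR _ ?_
    rw [Multiset.cons_swap]
    exact .negL _ (ih σ Γ Δ)
  | and φ ψ ih ih' =>
    refine .andL _ _ (.andR _ _ (ih σ _ Δ) ?_)
    rw [Multiset.cons_swap]
    exact ih' σ _ Δ
  | all φ ih =>
    obtain ⟨y, hyΓ, hyΔ, -⟩ := exists_notFreeIn ((φ.all).subst σ ::ₘ Γ) Δ ∅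
    refine .allR _ y hyΓ hyΔ (hyΓ _ (Multiset.mem_cons_self _ _)) (.allL _ (fvar y) ?_)
    rw [subst_lift_inst, Multiset.cons_swap]
    exact ih _ _ Δ

theorem identity (φ : ArithFml 0) (Γ Δ : Multiset (ArithFml 0)) : QG (φ ::ₘ Γ) (φ ::ₘ Δ) := by
  simpa only [Fml.subst_bvar] using identity_subst bvar φ Γ Δ

section Inversion

variable {Γ Δ : Multiset (ArithFml 0)} {φ ψ : ArithFml 0}

theorem cut_right (h : QG Γ (φ ::ₘ Δ)) (hφψ : QG (φ ::ₘ Γ) (ψ ::ₘ Δ)) : QG Γ (ψ ::ₘ Δ) := by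
  refine .cut φ (QG.weaken h le_rfl ?_) hφψ
  rw [Multiset.cons_swap]
  exact Multiset.le_cons_self _ _

theorem neg_right_iff : QG Γ (neg φ ::ₘ Δ) ↔ QG (φ ::ₘ Γ) Δ := by
  refine ⟨fun h => .cut (neg φ) (h.weaken (Multiset.le_cons_self _ _) le_rfl) ?_, .negR φ⟩
  exact .negL φ (identity φ Γ Δ)

theorem neg_left_iff : QG (neg φ ::ₘ Γ) Δ ↔ QG Γ (φ ::ₘ Δ) := by
  refine ⟨fun h => .cut (neg φ) (.negR φ (identity φ Γ Δ)) (h.weaken le_rfl ?_), .negL φ⟩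
  exact Multiset.le_cons_self _ _

theorem and_right_iff : QG Γ (and φ ψ ::ₘ Δ) ↔ QG Γ (φ ::ₘ Δ) ∧ QG Γ (ψ ::ₘ Δ) := by
  refine ⟨fun h => ⟨h.cut_right (.andL φ ψ (identity φ _ Δ)), h.cut_right (.andL φ ψ ?_)⟩,
    fun h => .andR φ ψ h.1 h.2⟩
  rw [Multiset.cons_swap]
  exact identity ψ _ Δ

theorem all_right_iff {χ : ArithFml 1} :
    QG Γ (all χ ::ₘ Δ) ↔ ∀ t, QG Γ (χ.inst t ::ₘ Δ) := by
  refine ⟨fun h t => h.cut_right (.allL χ t ?_), fun h => ?_⟩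
  · rw [Multiset.cons_swap]
    exact identity (χ.inst t) _ Δ
  · obtain ⟨y, hyΓ, hyΔ, hy⟩ := exists_notFreeIn Γ Δ (all χ).fv
    exact .allR χ y hyΓ hyΔ hy (h (fvar y))

end Inversion

/-! ### The axioms of Robinson arithmetic at arbitrary terms -/

theorem inst_of_closed {φ : ArithFml 1} (hφ : φ.fv = ∅) (h : QG 0 {φ.inst (fvar 0)}) (t : Tm 0) :
    QG 0 {φ.inst t} := by
  have hall : QG 0 {all φ} :=
    .allR φ 0 (notFreeIn_zero 0) (notFreeIn_zero 0) (by simp [Fml.fv, hφ]) h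
  exact all_right_iff.1 hall t

theorem subst_of_closed {φ : ArithFml 2} (hφ : φ.fv = ∅) (hφ₀ : 1 ∉ (φ.all.inst (fvar 0)).fv)
    (h : QG 0 {φ.subst (Fin.cases (fvar 1) fun _ => fvar 0)}) (s t : Tm 0) :
    QG 0 {φ.subst (Fin.cases t fun _ => s)} := by
  have hall : QG 0 {φ.all.inst (fvar 0)} := by
    refine .allR (Δ := 0) _ 1 (notFreeIn_zero 1) (notFreeIn_zero 1) hφ₀ ?_
    rw [subst_lift_inst]
    exact h
  have hall' := all_right_iff.1 (inst_of_closed hφ hall s) t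
  rwa [subst_lift_inst] at hall'

theorem succ_ne_zero (t : Tm 0) : QG 0 {(neg (eq (succ t) zero) : ArithFml 0)} :=
  inst_of_closed (φ := neg (eq (succ (bvar 0)) zero)) rfl (.negR (Δ := 0) _ (.q1 0)) t

theorem add_zero (t : Tm 0) : QG 0 {(eq (add t zero) t : ArithFml 0)} :=
  inst_of_closed (φ := eq (add (bvar 0) zero) (bvar 0)) rfl (.q4 0 (.ref _ _)) t

theorem mul_zero (t : Tm 0) : QG 0 {(eq (mul t zero) zero : ArithFml 0)} :=
  inst_of_closed (φ := eq (mul (bvar 0) zero) zero) rfl (.q6 0 (.ref _ _)) t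

theorem add_succ (s t : Tm 0) :
    QG 0 {(eq (add s (succ t)) (succ (add s t)) : ArithFml 0)} :=
  subst_of_closed (φ := eq (add (bvar 1) (succ (bvar 0))) (succ (add (bvar 1) (bvar 0)))) rfl
    (by decide) (.q5 0 1 (.ref _ _)) s t

theorem mul_succ (s t : Tm 0) :
    QG 0 {(eq (mul s (succ t)) (add (mul s t) s) : ArithFml 0)} :=
  subst_of_closed
    (φ := eq (mul (bvar 1) (succ (bvar 0))) (add (mul (bvar 1) (bvar 0)) (bvar 1))) rfl
    (by decide) (.q7 0 1 (.ref _ _)) s t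

theorem succ_inj (s t : Tm 0) :
    QG 0 {(neg (and (eq (succ s) (succ t)) (neg (eq s t))) : ArithFml 0)} := by
  refine subst_of_closed
    (φ := neg (and (eq (succ (bvar 1)) (succ (bvar 0))) (neg (eq (bvar 1) (bvar 0))))) rfl
    (by decide) (.negR (Δ := 0) _ (.andL _ _ ?_)) s t
  rw [Multiset.cons_swap]
  exact .negL _ (.q2 0 1 (.ref _ _))

theorem zero_or_succ (t : Tm 0) :
    QG 0 {(neg (and (neg (eq t zero)) (all (neg (eq t.shift (succ (bvar 0)))))) : ArithFml 0)} := by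
  refine inst_of_closed
    (φ := neg (and (neg (eq (bvar 0) zero)) (all (neg (eq (bvar 1) (succ (bvar 0)))))))
    rfl (.negR (Δ := 0) _ (.andL _ _ (.negL _ ?_))) t
  refine .q3 0 1 ?_ ?_ one_ne_zero (.ref _ _) ?_
  · intro φ hφ
    obtain rfl := Multiset.mem_singleton.1 hφ
    decide
  · intro φ hφ
    obtain rfl := Multiset.mem_singleton.1 hφ
    decide
  · rw [Multiset.cons_swap]
    refine .allL _ (fvar 1) ?_
    rw [Multiset.cons_swap]
    refine .negL _ ?_
    rw [Multiset.cons_swap]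
    exact .ref _ _

end QG

/-! ### Partial Boolean-valued semantics -/

namespace Fml

variable {B : Type*} [CompleteBooleanAlgebra B] {U : Type} {n m : ℕ}

/-- The strong Kleene value of a formula in the structure of terms, as the pair of its truth and
its falsity in the Boolean algebra `B`. Equations are interpreted by `E`, predicates partially by
`X`, quantifiers range over all terms, `ρ` assigns terms to the free variables and `σ` to the
bound variables in scope. The product order on `B × B` is the order of information. -/
def value (E : Tm 0 → Tm 0 → B) (X : U → Tm 0 → B × B) (ρ : ℕ → Tm 0) :
    {n : ℕ} → (Fin n → Tm 0) → Fml U n → B × B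
  | _, σ, eq s t => (E (s.bind ρ σ) (t.bind ρ σ), (E (s.bind ρ σ) (t.bind ρ σ))ᶜ)
  | _, σ, pred u t => X u (t.bind ρ σ)
  | _, σ, neg φ => (value E X ρ σ φ).swap
  | _, σ, and φ ψ =>
    ((value E X ρ σ φ).1 ⊓ (value E X ρ σ ψ).1, (value E X ρ σ φ).2 ⊔ (value E X ρ σ ψ).2)
  | _, σ, all φ =>
    (⨅ a, (value E X ρ (Fin.cases a σ) φ).1, ⨆ a, (value E X ρ (Fin.cases a σ) φ).2)

variable (E : Tm 0 → Tm 0 → B) (X : U → Tm 0 → B × B) (ρ : ℕ → Tm 0)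

theorem value_subst (τ : Fin n → Tm m) (σ : Fin m → Tm 0) (φ : Fml U n) :
    (φ.subst τ).value E X ρ σ = φ.value E X ρ fun i => (τ i).bind ρ σ := by
  induction φ generalizing m with
  | eq | pred => simp only [subst, value, Tm.subst_bind]
  | neg φ ih => simp only [subst, value, ih]
  | and φ ψ ih ih' => simp only [subst, value, ih, ih']
  | all φ ih =>
    have hlift (a : Tm 0) : (fun i => (Fin.cases (Tm.bvar 0) (fun i => (τ i).shift) i :
        Tm (m + 1)).bind ρ (Fin.cases a σ)) = Fin.cases a fun i => (τ i).bind ρ σ :=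
      funext (Fin.cases rfl fun i => Tm.shift_bind ρ a σ (τ i))
    simp only [subst, value, ih, hlift]

theorem value_inst (φ : Fml U 1) (t : Tm 0) (σ : Fin 0 → Tm 0) :
    (φ.inst t).value E X ρ σ = φ.value E X ρ (Fin.cases (t.bind ρ σ) σ) := by
  rw [inst, value_subst]
  congr 1
  exact funext (Fin.cases rfl fun i => i.elim0)

variable {ρ} in
theorem value_congr {ρ' : ℕ → Tm 0} {σ : Fin n → Tm 0} {φ : Fml U n}
    (h : ∀ x ∈ φ.fv, ρ x = ρ' x) : φ.value E X ρ σ = φ.value E X ρ' σ := by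
  induction φ with
  | eq s t =>
    simp only [fv, Finset.mem_union] at h
    simp only [value, Tm.bind_congr fun x hx => h x (.inl hx),
      Tm.bind_congr fun x hx => h x (.inr hx)]
  | pred u t => simp only [value, Tm.bind_congr h]
  | neg φ ih => simp only [value, ih h]
  | and φ ψ ih ih' =>
    simp only [fv, Finset.mem_union] at h
    simp only [value, ih fun x hx => h x (.inl hx), ih' fun x hx => h x (.inr hx)]
  | all φ ih => simp only [value, ih h]

theorem value_update {φ : Fml U n} {y : ℕ} (hy : y ∉ φ.fv) (a : Tm 0) (σ : Fin n → Tm 0) :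
    φ.value E X (Function.update ρ y a) σ = φ.value E X ρ σ :=
  value_congr E X fun _ hx => Function.update_of_ne (ne_of_mem_of_not_mem hx hy) _ _

theorem IsSentence.value_eq {φ : Fml U 0} (hφ : φ.IsSentence) (ρ' : ℕ → Tm 0)
    (σ : Fin 0 → Tm 0) : φ.value E X ρ σ = φ.value E X ρ' σ :=
  value_congr E X fun x hx => absurd (hφ ▸ hx) (Finset.notMem_empty x)

theorem value_mono (σ : Fin n → Tm 0) (φ : Fml U n) :
    Monotone fun X : U → Tm 0 → B × B => φ.value E X ρ σ := by
  intro X X' hX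
  induction φ with
  | eq => exact le_rfl
  | pred u t => exact hX u _
  | neg φ ih => exact ⟨(ih σ).2, (ih σ).1⟩
  | and φ ψ ih ih' =>
    exact ⟨inf_le_inf (ih σ).1 (ih' σ).1, sup_le_sup (ih σ).2 (ih' σ).2⟩
  | all φ ih => exact ⟨iInf_mono fun a => (ih _).1, iSup_mono fun a => (ih _).2⟩

/-- The duality `v ↦ v.swapᶜ` commutes with strong Kleene evaluation; truth and falsity of `v` are
disjoint exactly if `v ≤ v.swapᶜ`. -/
theorem value_swap_compl (σ : Fin n → Tm 0) (φ : Fml U n) :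
    φ.value E (fun u t => (X u t).swapᶜ) ρ σ = (φ.value E X ρ σ).swapᶜ := by
  induction φ with
  | eq => exact Prod.ext (compl_compl _).symm rfl
  | pred => rfl
  | neg φ ih => exact congrArg Prod.swap (ih σ)
  | and φ ψ ih ih' =>
    simp only [value, ih, ih']
    exact Prod.ext compl_sup.symm compl_inf.symm
  | all φ ih =>
    simp only [value, ih]
    exact Prod.ext compl_iSup.symm compl_iInf.symm

variable {X} in
theorem disjoint_value (hX : X ≤ fun u t => (X u t).swapᶜ) (σ : Fin n → Tm 0) (φ : Fml U n) :
    Disjoint (φ.value E X ρ σ).1 (φ.value E X ρ σ).2 :=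
  le_compl_iff_disjoint_right.1
    ((value_mono E ρ σ φ hX).trans_eq (value_swap_compl E X ρ σ φ)).1

end Fml

/-! ### Kripke's least fixed point -/

section Kripke

variable {B : Type*} [CompleteBooleanAlgebra B]

/-- Kripke's operator on partial interpretations of the truth predicate: the revised value of `T`
at the code of a sentence is the value of that sentence. Terms that are not the numeral of the
code of a sentence get the undefined value `⊥`. -/
def kripkeJump (code : TruthFml 0 → ℕ) (E : Tm 0 → Tm 0 → B) :
    (Tm 0 → B × B) →o (Tm 0 → B × B) where
  toFun X t := ⨆ (φ : TruthFml 0) (_ : φ.IsSentence ∧ t = Tm.numeral (code φ)),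
    φ.value E (fun _ => X) Tm.fvar Fin.elim0
  monotone' _ _ hX _ := iSup₂_mono fun φ _ => φ.value_mono E Tm.fvar Fin.elim0 fun _ => hX

variable {code : TruthFml 0 → ℕ} (hcode : Set.InjOn code {φ | φ.IsSentence})
  (E : Tm 0 → Tm 0 → B)

include hcode

theorem kripkeJump_numeral (X : Tm 0 → B × B) {φ : TruthFml 0} (hφ : φ.IsSentence) :
    kripkeJump code E X (Tm.numeral (code φ)) = φ.value E (fun _ => X) Tm.fvar Fin.elim0 := by
  refine le_antisymm (iSup₂_le fun ψ hψ => ?_) (le_iSup₂_of_le φ ⟨hφ, rfl⟩ le_rfl)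
  rw [hcode hφ hψ.1 (Tm.numeral_injective hψ.2)]

theorem kripkeJump_swap_compl_le (X : Tm 0 → B × B) :
    kripkeJump code E (fun t => (X t).swapᶜ) ≤ fun t => (kripkeJump code E X t).swapᶜ := by
  refine fun t => iSup₂_le fun φ hφ => ?_
  obtain ⟨hφ, rfl⟩ := hφ
  simp only [kripkeJump_numeral hcode E X hφ, Fml.value_swap_compl, le_refl]

theorem lfp_kripkeJump_le_swap_compl :
    (kripkeJump code E).lfp ≤ fun t => ((kripkeJump code E).lfp t).swapᶜ := by
  refine OrderHom.lfp_le _ ((kripkeJump_swap_compl_le hcode E _).trans_eq ?_)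
  rw [OrderHom.map_lfp]

theorem value_truth_lfp_kripkeJump {φ : TruthFml 0} (hφ : φ.IsSentence) (ρ : ℕ → Tm 0) :
    (TruthFml.T (Tm.numeral (code φ))).value E (fun _ => (kripkeJump code E).lfp) ρ Fin.elim0 =
      φ.value E (fun _ => (kripkeJump code E).lfp) ρ Fin.elim0 := by
  rw [Fml.value, Tm.numeral_bind, ← OrderHom.map_lfp, kripkeJump_numeral hcode E _ hφ,
    OrderHom.map_lfp]
  exact hφ.value_eq E _ Tm.fvar ρ Fin.elim0

end Kripke

/-! ### Soundness -/

section Soundness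

variable {B : Type*} [CompleteBooleanAlgebra B]

/-- A `B`-valued interpretation `E` of equality in the structure of terms that satisfies the axioms
of Robinson arithmetic. -/
structure IsRobinson (E : Tm 0 → Tm 0 → B) : Prop where
  refl (t : Tm 0) : E t t = ⊤
  replace (s t : Tm 0) (a b : Tm 1) :
    E s t ⊓ E (a.inst t) (b.inst t) ≤ E (a.inst s) (b.inst s)
  succ_ne_zero (t : Tm 0) : E t.succ .zero = ⊥
  succ_inj (s t : Tm 0) : E s.succ t.succ ≤ E s t
  zero_or_succ (t : Tm 0) : E t .zero ⊔ ⨆ u : Tm 0, E t u.succ = ⊤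
  add_zero (t : Tm 0) : E (t.add .zero) t = ⊤
  add_succ (s t : Tm 0) : E (s.add t.succ) (s.add t).succ = ⊤
  mul_zero (t : Tm 0) : E (t.mul .zero) .zero = ⊤
  mul_succ (s t : Tm 0) : E (s.mul t.succ) ((s.mul t).add s) = ⊤

variable {U : Type} (E : Tm 0 → Tm 0 → B) (X : U → Tm 0 → B × B) (ρ : ℕ → Tm 0)
  (Γ Δ : Multiset (Fml U 0))

/-- The value of the sequent `Γ ⇒ Δ`: some formula of `Γ` is false or some formula of `Δ` is
true. -/
def sequentValue : B :=
  (Γ.map fun φ => (φ.value E X ρ Fin.elim0).2).sup ⊔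
    (Δ.map fun φ => (φ.value E X ρ Fin.elim0).1).sup

theorem sequentValue_cons_left (φ : Fml U 0) : sequentValue E X ρ (φ ::ₘ Γ) Δ =
    (φ.value E X ρ Fin.elim0).2 ⊔ sequentValue E X ρ Γ Δ := by
  simp only [sequentValue, Multiset.map_cons, Multiset.sup_cons, sup_assoc]

theorem sequentValue_cons_right (φ : Fml U 0) : sequentValue E X ρ Γ (φ ::ₘ Δ) =
    (φ.value E X ρ Fin.elim0).1 ⊔ sequentValue E X ρ Γ Δ := by
  simp only [sequentValue, Multiset.map_cons, Multiset.sup_cons, sup_left_comm]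

variable {Γ Δ} in
theorem sequentValue_update {y : ℕ} (hΓ : NotFreeIn y Γ) (hΔ : NotFreeIn y Δ) (a : Tm 0) :
    sequentValue E X (Function.update ρ y a) Γ Δ = sequentValue E X ρ Γ Δ := by
  unfold sequentValue
  congr 2 <;> refine Multiset.map_congr rfl fun φ hφ => ?_
  · rw [Fml.value_update E X ρ (hΓ φ hφ)]
  · rw [Fml.value_update E X ρ (hΔ φ hφ)]

theorem compl_sup_eq_top_iff {a b : B} : aᶜ ⊔ b = ⊤ ↔ a ≤ b := by
  rw [sup_comm, ← himp_eq, himp_eq_top_iff]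

variable {E X Γ Δ}

theorem sequentValue_eq_top_of_cut {φ : Fml U 0}
    (hφ : Disjoint (φ.value E X ρ Fin.elim0).1 (φ.value E X ρ Fin.elim0).2)
    (h : sequentValue E X ρ Γ (φ ::ₘ Δ) = ⊤) (h' : sequentValue E X ρ (φ ::ₘ Γ) Δ = ⊤) :
    sequentValue E X ρ Γ Δ = ⊤ := by
  rw [sequentValue_cons_right] at h
  rw [sequentValue_cons_left] at h'
  rw [← bot_sup_eq (sequentValue E X ρ Γ Δ), ← hφ.eq_bot, sup_inf_right, h, h', inf_top_eq]

theorem sequentValue_cons_left_of_le {φ : Fml U 0}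
    (hφ : (φ.value E X ρ Fin.elim0).2 ≤ sequentValue E X ρ Γ Δ) :
    sequentValue E X ρ (φ ::ₘ Γ) Δ = sequentValue E X ρ Γ Δ := by
  rw [sequentValue_cons_left, sup_eq_right.2 hφ]

theorem sequentValue_cons_eq_left {s t : Tm 0}
    (h : E (s.bind ρ Fin.elim0) (t.bind ρ Fin.elim0) = ⊤) :
    sequentValue E X ρ (.eq s t ::ₘ Γ) Δ = sequentValue E X ρ Γ Δ := by
  rw [sequentValue_cons_left, Fml.value, h, compl_top, bot_sup_eq]

theorem sequentValue_all_left (φ : Fml U 1) (t : Tm 0) :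
    sequentValue E X ρ (.all φ ::ₘ φ.inst t ::ₘ Γ) Δ = sequentValue E X ρ (.all φ ::ₘ Γ) Δ := by
  rw [Multiset.cons_swap]
  apply sequentValue_cons_left_of_le
  rw [sequentValue_cons_left, Fml.value_inst]
  exact le_sup_of_le_left (le_iSup (fun a => (φ.value E X ρ (Fin.cases a Fin.elim0)).2) _)

theorem sequentValue_all_right {φ : Fml U 1} {y : ℕ} (hΓ : NotFreeIn y Γ) (hΔ : NotFreeIn y Δ)
    (hφ : y ∉ φ.fv)
    (h : ∀ a, sequentValue E X (Function.update ρ y a) Γ (φ.inst (.fvar y) ::ₘ Δ) = ⊤) :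
    sequentValue E X ρ Γ (.all φ ::ₘ Δ) = ⊤ := by
  rw [sequentValue_cons_right, Fml.value, iInf_sup_eq, iInf_eq_top]
  intro a
  have ha := h a
  rwa [sequentValue_cons_right, sequentValue_update E X ρ hΓ hΔ, Fml.value_inst,
    Fml.value_update E X ρ hφ, Tm.bind, Function.update_self] at ha

theorem sequentValue_zero_or_succ (hE : IsRobinson E) {x y : ℕ} (hΓ : NotFreeIn y Γ)
    (hΔ : NotFreeIn y Δ) (hyx : y ≠ x)
    (h : sequentValue E X ρ (.eq (.fvar x) .zero ::ₘ Γ) Δ = ⊤)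
    (h' : ∀ a, sequentValue E X (Function.update ρ y a)
      (.eq (.fvar x) (.succ (.fvar y)) ::ₘ Γ) Δ = ⊤) :
    sequentValue E X ρ Γ Δ = ⊤ := by
  rw [sequentValue_cons_left, Fml.value, compl_sup_eq_top_iff] at h
  refine top_le_iff.1 ((hE.zero_or_succ (ρ x)).ge.trans (sup_le h (iSup_le fun a => ?_)))
  have ha := h' a
  rw [sequentValue_cons_left, sequentValue_update E X ρ hΓ hΔ, Fml.value,
    compl_sup_eq_top_iff] at ha
  simpa only [Tm.bind, Function.update_self, Function.update_of_ne hyx.symm] using ha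

theorem sequentValue_succ_inj (hE : IsRobinson E) (s t : Tm 0) :
    sequentValue E X ρ (.eq s t ::ₘ .eq s.succ t.succ ::ₘ Γ) Δ =
      sequentValue E X ρ (.eq s.succ t.succ ::ₘ Γ) Δ := by
  apply sequentValue_cons_left_of_le
  rw [sequentValue_cons_left]
  exact le_sup_of_le_left (compl_le_compl (hE.succ_inj _ _))

theorem sequentValue_replace (hE : IsRobinson E) (s t : Tm 0) (a b : Tm 1) :
    sequentValue E X ρ
        (.eq s t ::ₘ .eq (a.inst s) (b.inst s) ::ₘ .eq (a.inst t) (b.inst t) ::ₘ Γ) Δ =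
      sequentValue E X ρ (.eq s t ::ₘ .eq (a.inst t) (b.inst t) ::ₘ Γ) Δ := by
  rw [Multiset.cons_swap]
  apply sequentValue_cons_left_of_le
  simp only [sequentValue_cons_left, Fml.value, Tm.inst_bind, ← sup_assoc, ← compl_inf]
  exact le_sup_of_le_left (compl_le_compl (hE.replace _ _ _ _))

theorem Derivable.sequentValue_eq_top {Names : Fml U 0 → Fml U 0 → Prop} (hE : IsRobinson E)
    (hX : X ≤ fun u t => (X u t).swapᶜ)
    (hNames : ∀ φ ψ, Names φ ψ → ∀ ρ, ψ.value E X ρ Fin.elim0 = φ.value E X ρ Fin.elim0)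
    (h : Derivable Names Γ Δ) : sequentValue E X ρ Γ Δ = ⊤ := by
  induction h generalizing ρ with
  | ref s t =>
    rw [sequentValue_cons_left, sequentValue_cons_right, Fml.value, compl_sup_eq_top_iff]
    exact le_sup_left
  | cut φ _ _ ih ih' =>
    exact sequentValue_eq_top_of_cut ρ (Fml.disjoint_value E ρ hX _ φ) (ih ρ) (ih' ρ)
  | negL φ _ ih =>
    rw [sequentValue_cons_left, ← ih ρ, sequentValue_cons_right]
    rfl
  | negR φ _ ih =>
    rw [sequentValue_cons_right, ← ih ρ, sequentValue_cons_left]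
    rfl
  | andL φ ψ _ ih =>
    rw [← ih ρ, sequentValue_cons_left, sequentValue_cons_left, sequentValue_cons_left, Fml.value,
      sup_assoc]
  | andR φ ψ _ _ ih ih' =>
    rw [sequentValue_cons_right, Fml.value, sup_inf_right, ← sequentValue_cons_right,
      ← sequentValue_cons_right, ih, ih', inf_top_eq]
  | allL φ s _ ih => rw [← sequentValue_all_left ρ φ s, ih]
  | allR φ y hΓ hΔ hφ _ ih =>
    exact sequentValue_all_right ρ hΓ hΔ hφ fun a => ih _
  | eq1 t _ ih => rw [← ih ρ, sequentValue_cons_eq_left ρ (hE.refl _)]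
  | eq2 s t a b _ ih => rw [← sequentValue_replace ρ hE, ih]
  | q1 x =>
    rw [sequentValue_cons_left, Fml.value, compl_sup_eq_top_iff]
    exact (hE.succ_ne_zero _).trans_le bot_le
  | q2 x y _ ih => rw [← sequentValue_succ_inj ρ hE, ih]
  | q3 x y hΓ hΔ hyx _ _ ih ih' =>
    exact sequentValue_zero_or_succ ρ hE hΓ hΔ hyx (ih ρ) fun a => ih' _
  | q4 x _ ih => rw [← ih ρ, sequentValue_cons_eq_left ρ (hE.add_zero _)]
  | q5 x y _ ih => rw [← ih ρ, sequentValue_cons_eq_left ρ (hE.add_succ _ _)]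
  | q6 x _ ih => rw [← ih ρ, sequentValue_cons_eq_left ρ (hE.mul_zero _)]
  | q7 x y _ ih => rw [← ih ρ, sequentValue_cons_eq_left ρ (hE.mul_succ _ _)]
  | truthL φ ψ hφψ _ ih =>
    rw [sequentValue_cons_left, hNames φ ψ hφψ, ← sequentValue_cons_left, ih]
  | truthR φ ψ hφψ _ ih =>
    rw [sequentValue_cons_right, hNames φ ψ hφψ, ← sequentValue_cons_right, ih]

theorem LPTN.sequentValue_eq_top {code : TruthFml 0 → ℕ}
    (hcode : Set.InjOn code {φ | φ.IsSentence}) (hE : IsRobinson E)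
    {Γ Δ : Multiset (TruthFml 0)} (h : LPTN code Γ Δ) :
    sequentValue E (fun _ => (kripkeJump code E).lfp) ρ Γ Δ = ⊤ := by
  refine Derivable.sequentValue_eq_top ρ hE (fun _ => lfp_kripkeJump_le_swap_compl hcode E) ?_ h
  rintro φ _ ⟨hφ, rfl⟩ ρ
  exact value_truth_lfp_kripkeJump hcode E hφ ρ

end Soundness

/-! ### The Boolean algebra of regular sets of underivable sequents -/

/-- The complete Boolean algebra of regular elements of a frame. It is kept apart from its synonym
`Heyting.Regular α`, on which Mathlib puts the order and the Boolean operations only. -/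
def RegularElement (α : Type*) [Order.Frame α] : Type _ := Heyting.Regular α

namespace RegularElement

variable {α : Type*} [Order.Frame α]

instance : CompleteBooleanAlgebra (RegularElement α) where
  __ := (inferInstance : BooleanAlgebra (Heyting.Regular α))
  __ := (Heyting.Regular.gi.liftCompleteLattice : CompleteLattice (Heyting.Regular α))

theorem val_iInf {ι : Sort*} (a : ι → RegularElement α) : (⨅ i, a i).1 = ⨅ i, (a i).1 :=
  Heyting.Regular.gi.gc.u_iInf

theorem exists_le_iff (a : α) : ∃ b : RegularElement α, ∀ c, b ≤ c ↔ a ≤ c.1 :=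
  ⟨Heyting.Regular.toRegular a, Heyting.Regular.gi.gc a⟩

end RegularElement

theorem mem_compl_lowerSet_iff {P : Type*} [Preorder P] {a : LowerSet P} {p : P} :
    p ∈ aᶜ ↔ ∀ q ≤ p, q ∉ a := by
  rw [← LowerSet.Iic_le, le_compl_iff_disjoint_right, disjoint_iff_inf_le]
  exact ⟨fun h q hq ha => h ⟨hq, ha⟩, fun h q hq => h q hq.1 hq.2⟩

/-- An arithmetical sequent that is not derivable in `Q^g`. -/
structure UnderivableSequent where
  left : Multiset (ArithFml 0)
  right : Multiset (ArithFml 0)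
  not_qg : ¬ QG left right

/-- As in forcingSet, the sequent with more formulas is the stronger condition and hence smaller. -/
instance : Preorder UnderivableSequent where
  le p q := q.left ≤ p.left ∧ q.right ≤ p.right
  le_refl _ := ⟨le_rfl, le_rfl⟩
  le_trans _ _ _ hpq hqr := ⟨hqr.1.trans hpq.1, hqr.2.trans hpq.2⟩

/-- The Boolean completion of the order of underivable sequents. -/
abbrev TruthValue : Type := RegularElement (LowerSet UnderivableSequent)

namespace ArithFml

open Fml

/-- The conditions `Γ ⇒ Δ` that force `φ`, in the sense that `Γ ⇒ φ, Δ` is derivable. -/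
def forcingSet (φ : ArithFml 0) : LowerSet UnderivableSequent where
  carrier := {p | QG p.left (φ ::ₘ p.right)}
  lower' _ _ h hp := hp.weaken h.1 (Multiset.cons_le_cons φ h.2)

theorem forcingSet_neg (φ : ArithFml 0) : forcingSet (neg φ) = (forcingSet φ)ᶜ := by
  ext p
  rw [SetLike.mem_coe, SetLike.mem_coe, mem_compl_lowerSet_iff]
  refine QG.neg_right_iff.trans ⟨fun h q hq hφ => q.not_qg (.cut φ hφ ?_), fun h => ?_⟩
  · exact h.weaken (Multiset.cons_le_cons φ hq.1) hq.2
  · by_contra hp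
    exact h ⟨φ ::ₘ p.left, p.right, hp⟩ ⟨Multiset.le_cons_self _ _, le_rfl⟩ (QG.identity φ _ _)

theorem forcingSet_neg_neg (φ : ArithFml 0) : forcingSet (neg (neg φ)) = forcingSet φ :=
  SetLike.ext fun _ => QG.neg_right_iff.trans QG.neg_left_iff

/-- The Boolean truth value of `φ`. The set of conditions that force `φ` is regular since `φ` and
`¬¬φ` are interderivable. -/
def truthValue (φ : ArithFml 0) : TruthValue :=
  ⟨forcingSet φ, by rw [Heyting.IsRegular, ← forcingSet_neg, ← forcingSet_neg, forcingSet_neg_neg]⟩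

theorem truthValue_neg (φ : ArithFml 0) : truthValue (neg φ) = (truthValue φ)ᶜ :=
  Subtype.ext (forcingSet_neg φ)

theorem truthValue_and (φ ψ : ArithFml 0) :
    truthValue (and φ ψ) = truthValue φ ⊓ truthValue ψ :=
  Subtype.ext (SetLike.ext fun _ => QG.and_right_iff)

theorem truthValue_all (χ : ArithFml 1) : truthValue (all χ) = ⨅ t, truthValue (χ.inst t) := by
  refine Subtype.ext (SetLike.ext fun p => QG.all_right_iff.trans ?_)
  rw [RegularElement.val_iInf, LowerSet.mem_iInf_iff]
  rfl

theorem truthValue_eq_top {φ : ArithFml 0} (h : QG 0 {φ}) : truthValue φ = ⊤ :=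
  top_le_iff.1 fun p _ => h.weaken (Multiset.zero_le _)
    (Multiset.singleton_le.2 (Multiset.mem_cons_self φ p.right))

theorem truthValue_le {φ ψ : ArithFml 0} (h : QG {φ} {ψ}) : truthValue φ ≤ truthValue ψ :=
  fun _ hφ => QG.cut_right hφ (h.weaken (Multiset.singleton_le.2 (Multiset.mem_cons_self _ _))
    (Multiset.singleton_le.2 (Multiset.mem_cons_self _ _)))

theorem isRobinson_truthValue : IsRobinson fun s t => truthValue (eq s t) where
  refl t := truthValue_eq_top (.eq1 t (.ref t t))
  replace s t a b := by
    rw [← truthValue_and]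
    refine truthValue_le (.andL _ _ (.eq2 s t a b ?_))
    rw [Multiset.cons_swap]
    exact .ref _ _
  succ_ne_zero t := by
    rw [← compl_eq_top, ← truthValue_neg, truthValue_eq_top (QG.succ_ne_zero t)]
  succ_inj s t := by
    have h := truthValue_eq_top (QG.succ_inj s t)
    rwa [truthValue_neg, truthValue_and, truthValue_neg, compl_eq_top, ← disjoint_iff,
      disjoint_compl_right_iff] at h
  zero_or_succ t := by
    have h := truthValue_eq_top (QG.zero_or_succ t)
    have hinst (u : Tm 0) : (neg (eq t.shift (.succ (.bvar 0))) : ArithFml 1).inst u =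
        neg (eq t u.succ) :=
      congrArg (fun s => neg (eq s u.succ)) (Tm.shift_inst t u)
    simpa only [truthValue_neg, truthValue_and, truthValue_all, compl_inf, compl_compl, compl_iInf,
      hinst] using h
  add_zero t := truthValue_eq_top (QG.add_zero t)
  add_succ s t := truthValue_eq_top (QG.add_succ s t)
  mul_zero t := truthValue_eq_top (QG.mul_zero t)
  mul_succ s t := truthValue_eq_top (QG.mul_succ s t)

theorem value_toTruth (X : Unit → Tm 0 → TruthValue × TruthValue) {n : ℕ}
    (σ : Fin n → Tm 0) (φ : ArithFml n) :
    φ.toTruth.value (fun s t => truthValue (eq s t)) X Tm.fvar σ =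
      (truthValue (φ.subst σ), (truthValue (φ.subst σ))ᶜ) := by
  induction φ with
  | eq s t => simp only [toTruth, value, Tm.bind_fvar, subst]
  | pred u => exact u.elim
  | neg φ ih => simp only [toTruth, value, ih, subst, truthValue_neg, compl_compl, Prod.swap]
  | and φ ψ ih ih' => simp only [toTruth, value, ih, ih', subst, truthValue_and, compl_inf]
  | all φ ih =>
    simp only [toTruth, value, ih, subst, truthValue_all, subst_lift_inst, compl_iInf]

end ArithFml

open ArithFml in
theorem QG.of_truthValue_eq_top {Γ Δ : Multiset (ArithFml 0)}
    (h : (Γ.map fun φ => (truthValue φ)ᶜ).sup ⊔ (Δ.map truthValue).sup = ⊤) : QG Γ Δ := by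
  by_contra hΓΔ
  let p : UnderivableSequent := ⟨Γ, Δ, hΓΔ⟩
  obtain ⟨b, hb⟩ := RegularElement.exists_le_iff (LowerSet.Iic p)
  have hleft : ∀ φ ∈ Γ, b ≤ truthValue φ := by
    intro φ hφ
    obtain ⟨Γ', rfl⟩ := Multiset.exists_cons_of_mem hφ
    exact (hb _).2 (LowerSet.Iic_le.2 <| QG.identity φ Γ' Δ)
  have hright : ∀ φ ∈ Δ, b ≤ (truthValue φ)ᶜ := by
    intro φ hφ
    obtain ⟨Δ', rfl⟩ := Multiset.exists_cons_of_mem hφ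
    rw [← truthValue_neg]
    exact (hb _).2 (LowerSet.Iic_le.2 <| QG.neg_right_iff.2 (QG.identity φ Γ Δ'))
  have htop : ⊤ ≤ bᶜ := by
    rw [← h]
    refine sup_le (Multiset.sup_le.2 ?_) (Multiset.sup_le.2 ?_) <;>
      simp only [Multiset.mem_map, forall_exists_index, and_imp, forall_apply_eq_imp_iff₂]
    · exact fun φ hφ => compl_le_compl (hleft φ hφ)
    · exact fun φ hφ => le_compl_comm.1 (hright φ hφ)
  have hbot : b ≤ ⊥ := by rw [← compl_compl b, top_le_iff.1 htop, compl_top]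
  exact LowerSet.Iic_le.1 ((hb ⊥).1 hbot)

open ArithFml in
theorem LPTN.qg {code : TruthFml 0 → ℕ} (hcode : Set.InjOn code {φ | φ.IsSentence})
    {Γ Δ : Multiset (ArithFml 0)} (h : LPTN code (Γ.map toTruth) (Δ.map toTruth)) : QG Γ Δ := by
  have htop := h.sequentValue_eq_top Tm.fvar hcode isRobinson_truthValue
  simp only [sequentValue, Multiset.map_map, Function.comp_def, value_toTruth,
    Fml.subst_fin_zero] at htop
  exact QG.of_truthValue_eq_top htop

theorem mainTheorem3 (code : TruthFml 0 → ℕ)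
    (hcode : Set.InjOn code {φ | φ.IsSentence}) :
    (∀ Γ Δ : Multiset (TruthFml 0), QG Γ Δ → LPTN code Γ Δ) ∧
    (∀ Γ Δ : Multiset (ArithFml 0),
      (LPTN code (Γ.map ArithFml.toTruth) (Δ.map ArithFml.toTruth) ↔
        QG (Γ.map ArithFml.toTruth) (Δ.map ArithFml.toTruth)) ∧
      (LPTN code (Γ.map ArithFml.toTruth) (Δ.map ArithFml.toTruth) ↔ QG Γ Δ)) :=
  ⟨fun _ _ h => h.derivable _, fun _ _ =>
    ⟨⟨fun h => (h.qg hcode).map_toTruth, fun h => h.derivable _⟩,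
      ⟨fun h => h.qg hcode, fun h => h.map_toTruth.derivable _⟩⟩⟩
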